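/- Let $M\ge 1$ and let $\alpha_1,\dots,\alpha_M\ge 0$ with $\alpha_1+\dots+\alpha_M=1$. For group sizes $N_1,\dots,N_M$ with $N=N_1+\dots+N_M\geq 1$, consider the multi-group Curie–Weiss model with homogeneous coupling matrix at the critical inverse temperature $\beta=1$: random spins $X_{\nu i}\in\{-1,1\}$ ($1\le \nu\le M$, $1\le i\le N_\nu$) with $$\mathbb P\bigl(X_{\nu i}=x_{\nu i}\ \text{for all } \nu,i\bigr)=Z^{-1}\exp\Bigl(\frac{1}{2N}\sum_{\lambda,\nu=1}^{M}\sum_{i=1}^{N_\lambda}\sum_{j=1}^{N_\nu}x_{\lambda i}x_{\nu j}\Bigr),$$ where $Z$ is the normalisation constant, and let $S_\nu=\sum_{i=1}^{N_\nu}X_{\nu i}$ be the magnetisation of group $\nu$. Then there is a probability measure $\mu$ on $\mathbb R^M$, depending only on $(\alpha_1,\dots,\alpha_M)$, such that for every sequence of group sizes along which $N_\nu\to\infty$ and $N_\nu/N\to\alpha_\nu$ for every $\nu$, $$\Bigl(\frac{S_1}{N_1^{3/4}},\dots,\frac{S_M}{N_M^{3/4}}\Bigr)\Longrightarrow\mu\qquad\text{weakly.}$$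 All moments of $\mu$ exist, and for all $K_1,\dots,K_M\in\{0,1,2,\dots\}$, with $K=K_1+\dots+K_M$, $$\int_{\mathbb R^M}x_1^{K_1}\cdots x_M^{K_M}\,\mu(dx)=\begin{cases}12^{K/4}\,\dfrac{\Gamma\left(\frac{K+1}{4}\right)}{\Gamma\left(\frac14\right)}\,\alpha_1^{K_1/4}\cdots\alpha_M^{K_M/4}, & K\text{ even},\\[2mm] 0, & K\text{ odd},\end{cases}$$ with the convention $0^0=1$. -/

import Mathlib

open Filter Topology MeasureTheory

noncomputable section

namespace CurieWeiss

/-- Spin configurations of `M` groups, the group `ν` having `N ν` spins. A spin takes its value in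
the two-element set `ℤˣ = {-1, 1}`. -/
abbrev Config {M : ℕ} (N : Fin M → ℕ) : Type :=
  (ν : Fin M) → Fin (N ν) → ℤˣ

/-- The total number `N = N₁ + ⋯ + N_M` of spins. -/
def total {M : ℕ} (N : Fin M → ℕ) : ℕ := ∑ ν, N ν

/-- The value of the `i`-th spin of the group `ν`, as a real number. -/
def spin {M : ℕ} {N : Fin M → ℕ} (x : Config N) (ν : Fin M) (i : Fin (N ν)) : ℝ :=
  ((x ν i : ℤ) : ℝ)

/-- The Hamiltonian of the multi-group Curie-Weiss model with coupling matrix `J`. -/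
def hamiltonian {M : ℕ} (J : Matrix (Fin M) (Fin M) ℝ) (N : Fin M → ℕ) (x : Config N) : ℝ :=
  -(1 / (2 * (total N : ℝ))) *
    ∑ ν, ∑ κ, J ν κ * ∑ i : Fin (N ν), ∑ j : Fin (N κ), spin x ν i * spin x κ j

/-- The normalisation constant `Z`. -/
def partitionFunction {M : ℕ} (J : Matrix (Fin M) (Fin M) ℝ) (N : Fin M → ℕ) : ℝ :=
  ∑ x : Config N, Real.exp (-hamiltonian J N x)

theorem partitionFunction_pos {M : ℕ} (J : Matrix (Fin M) (Fin M) ℝ) (N : Fin M → ℕ) :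
    0 < partitionFunction J N :=
  Finset.sum_pos (fun _ _ => Real.exp_pos _) Finset.univ_nonempty

/-- The canonical ensemble: the configuration `x` has probability `Z⁻¹ exp (-H(x))`. -/
def canonicalEnsemble {M : ℕ} (J : Matrix (Fin M) (Fin M) ℝ) (N : Fin M → ℕ) :
    PMF (Config N) :=
  PMF.ofFintype
    (fun x => ENNReal.ofReal ((partitionFunction J N)⁻¹ * Real.exp (-hamiltonian J N x)))
    (by
      rw [← ENNReal.ofReal_sum_of_nonneg (fun x _ => mul_nonneg
        (inv_nonneg.2 (partitionFunction_pos J N).le) (Real.exp_pos _).le), ← Finset.mul_sum]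
      change ENNReal.ofReal ((partitionFunction J N)⁻¹ * partitionFunction J N) = 1
      rw [inv_mul_cancel₀ (partitionFunction_pos J N).ne', ENNReal.ofReal_one])

/-- The homogeneous `M × M` coupling matrix, all of whose entries equal `β`. -/
def homogeneousCoupling (M : ℕ) (β : ℝ) : Matrix (Fin M) (Fin M) ℝ :=
  Matrix.of fun _ _ => β

/-- The magnetisation `S_ν`, the sum of all spins of the group `ν`. -/
def magnetisation {M : ℕ} {N : Fin M → ℕ} (x : Config N) (ν : Fin M) : ℝ :=
  ∑ i : Fin (N ν), spin x ν i

/-- The vector `(S₁ / N₁ ^ γ, …, S_M / N_M ^ γ)` of normalised magnetisations. -/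
def normalisedMagnetisation {M : ℕ} {N : Fin M → ℕ} (γ : ℝ) (x : Config N) : Fin M → ℝ :=
  fun ν => magnetisation x ν / (N ν : ℝ) ^ γ

/-- The law of the vector `(S₁ / N₁ ^ γ, …, S_M / N_M ^ γ)` under the canonical ensemble, as a
Borel probability measure on `ℝ ^ M`. -/
def normalisedLaw {M : ℕ} (J : Matrix (Fin M) (Fin M) ℝ) (γ : ℝ) (N : Fin M → ℕ) :
    ProbabilityMeasure (Fin M → ℝ) :=
  ⟨((canonicalEnsemble J N).map (normalisedMagnetisation γ)).toMeasure, inferInstance⟩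

end CurieWeiss

end

/-! With `S` the total magnetisation and `n` the number of spins, the weight is `exp (S² / 2n)`. Up
to a constant this is the Gaussian integral of `exp (-n y² / 2 + y S)` over `y`. The model is thus a
mixture, over a random field `y` with density proportional to `exp (-n (y² / 2 - log cosh y))`, of
independent spins of mean `tanh y` (`exists_pos_sum_exp_neg_hamiltonian`).

At `β = 1` the quadratic terms cancel and `y² / 2 - log cosh y ~ y⁴ / 12`. So for `y = t n ^ (-1/4)`
the law of `t` tends to the density proportional to `exp (-t⁴ / 12)`
(`tendsto_integral_fieldDensity_mul`). Given `t`, group `ν` has mean about `t N_ν n ^ (-1/4)` and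
fluctuations of order at most `√N_ν`, negligible against `N_ν ^ (3/4)`
(`abs_sum_fieldWeight_sub_le`). The normalised vector therefore follows `(α_ν ^ (1/4) t)_ν`. The
limit lives on a line, and its moments are one-dimensional Gamma integrals. -/

theorem integral_abs_pow_mul_exp_neg (k p : ℕ) (hp : p ≠ 0) {b : ℝ} (hb : 0 < b) :
    ∫ t : ℝ, |t| ^ k * Real.exp (-b * |t| ^ p) =
      2 * (b ^ (-((k : ℝ) + 1) / p) * (1 / p) * Real.Gamma (((k : ℝ) + 1) / p)) := by
  rw [integral_comp_abs (f := fun t : ℝ => t ^ k * Real.exp (-b * t ^ p)),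
    ← integral_rpow_mul_exp_neg_mul_rpow (by positivity)
      (lt_of_lt_of_le (by norm_num) (Nat.cast_nonneg k)) hb]
  simp_rw [Real.rpow_natCast]

/-- The integral of a non-integrable function is `0` by convention, whereas the closed formula gives
a positive value. -/
theorem integrable_abs_pow_mul_exp_neg (k p : ℕ) (hp : p ≠ 0) {b : ℝ} (hb : 0 < b) :
    Integrable fun t : ℝ => |t| ^ k * Real.exp (-b * |t| ^ p) := by
  by_contra h
  have h1 := integral_abs_pow_mul_exp_neg k p hp hb
  rw [integral_undef h] at h1
  have : 0 < Real.Gamma (((k : ℝ) + 1) / p) := Real.Gamma_pos_of_pos (by positivity)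
  have : 0 < b ^ (-((k : ℝ) + 1) / p) * (1 / (p : ℝ)) * Real.Gamma (((k : ℝ) + 1) / p) := by
    positivity
  linarith

/-! ### Elementary bounds on `tanh` and `log cosh` -/

namespace Real

theorem hasDerivAt_tanh_one_sub_sq (x : ℝ) : HasDerivAt tanh (1 - tanh x ^ 2) x := by
  have h := (hasDerivAt_sinh x).div (hasDerivAt_cosh x) (cosh_pos x).ne'
  have e : (fun y => sinh y / cosh y) = tanh := by
    ext y; rw [tanh_eq_sinh_div_cosh]
  have e' : sinh / cosh = tanh := e
  rw [e'] at h
  refine h.congr_deriv ?_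
  rw [tanh_eq_sinh_div_cosh]
  have := (cosh_pos x).ne'
  field_simp

theorem hasDerivAt_log_cosh (x : ℝ) : HasDerivAt (fun y => log (cosh y)) (tanh x) x := by
  rw [tanh_eq_sinh_div_cosh]
  exact (hasDerivAt_cosh x).log (cosh_pos x).ne'

/-- Each Taylor bound below integrates the preceding one, using `tanh' = 1 - tanh²` and `(log cosh)'
= tanh`. -/
theorem nonneg_of_hasDerivAt_nonneg {f f' : ℝ → ℝ} (hf : ∀ x, HasDerivAt f (f' x) x)
    (h0 : f 0 = 0) (hf' : ∀ x, 0 ≤ x → 0 ≤ f' x) {x : ℝ} (hx : 0 ≤ x) : 0 ≤ f x := by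
  rw [← h0]
  refine monotoneOn_of_hasDerivWithinAt_nonneg (f' := f') (convex_Ici 0)
    (fun y _ => (hf y).continuousAt.continuousWithinAt)
    (fun y _ => (hf y).hasDerivWithinAt) (fun y hy => ?_) Set.self_mem_Ici hx hx
  rw [interior_Ici] at hy
  exact hf' y (le_of_lt hy)

theorem tanh_nonneg_of_nonneg {x : ℝ} (hx : 0 ≤ x) : 0 ≤ tanh x := by
  rw [tanh_eq_sinh_div_cosh]
  exact div_nonneg (sinh_nonneg_iff.2 hx) (cosh_pos x).le

theorem tanh_le_self {x : ℝ} (hx : 0 ≤ x) : tanh x ≤ x := by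
  have := nonneg_of_hasDerivAt_nonneg (f := fun y => y - tanh y) (f' := fun y => tanh y ^ 2)
    (fun y => by convert! (hasDerivAt_id y).sub (hasDerivAt_tanh_one_sub_sq y) using 1; simp)
    (by simp) (fun y _ => sq_nonneg _) hx
  simpa using this

theorem self_sub_cube_le_tanh {x : ℝ} (hx : 0 ≤ x) : x - x ^ 3 / 3 ≤ tanh x := by
  have := nonneg_of_hasDerivAt_nonneg (f := fun y => tanh y - (y - y ^ 3 / 3))
    (f' := fun y => y ^ 2 - tanh y ^ 2)
    (fun y => by
      convert! (hasDerivAt_tanh_one_sub_sq y).sub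
        ((hasDerivAt_id y).sub ((hasDerivAt_pow 3 y).div_const 3)) using 1
      simp)
    (by simp)
    (fun y hy => sub_nonneg.2 (pow_le_pow_left₀ (tanh_nonneg_of_nonneg hy) (tanh_le_self hy) 2)) hx
  simpa using this

theorem tanh_le_quintic {x : ℝ} (hx : 0 ≤ x) : tanh x ≤ x - x ^ 3 / 3 + 2 * x ^ 5 / 15 := by
  have := nonneg_of_hasDerivAt_nonneg
    (f := fun y => (y - y ^ 3 / 3 + 2 * y ^ 5 / 15) - tanh y)
    (f' := fun y => tanh y ^ 2 - y ^ 2 + 2 * y ^ 4 / 3)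
    (fun y => by
      convert! (((hasDerivAt_id y).sub ((hasDerivAt_pow 3 y).div_const 3)).add
        (((hasDerivAt_pow 5 y).const_mul 2).div_const 15)).sub (hasDerivAt_tanh_one_sub_sq y)
        using 1
      simp; ring)
    (by simp) (fun y hy => ?_) hx
  · simpa using this
  · have h1 := self_sub_cube_le_tanh hy
    have h2 := tanh_nonneg_of_nonneg hy
    -- The lower bound on `tanh y` can be squared only where it is positive. Elsewhere `y² ≤ y⁴ /
    -- 3`, which already suffices.
    rcases le_or_gt (y - y ^ 3 / 3) 0 with h | h
    · have h3 : y * (1 - y ^ 2 / 3) ≤ 0 := by linarith [h]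
      have h4 : y * (y * (1 - y ^ 2 / 3)) ≤ 0 := mul_nonpos_of_nonneg_of_nonpos hy h3
      nlinarith [sq_nonneg (tanh y), sq_nonneg (y ^ 2)]
    · have h3 := pow_le_pow_left₀ h.le h1 2
      nlinarith [sq_nonneg (y ^ 3)]

theorem abs_tanh_sub_self_le (x : ℝ) : |tanh x - x| ≤ |x| ^ 3 / 3 := by
  wlog hx : 0 ≤ x generalizing x
  · have := this (-x) (by linarith)
    rw [tanh_neg, abs_neg] at this
    rwa [abs_sub_comm, show x - tanh x = -tanh x - -x by ring]
  · rw [abs_of_nonneg hx, abs_sub_comm, abs_of_nonneg (by linarith [tanh_le_self hx])]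
    linarith [self_sub_cube_le_tanh hx]

theorem half_sq_sub_log_cosh_le (x : ℝ) : x ^ 2 / 2 - log (cosh x) ≤ x ^ 4 / 12 := by
  wlog hx : 0 ≤ x generalizing x
  · simpa [Even.neg_pow (show Even 4 by decide)] using this (-x) (by linarith)
  have := nonneg_of_hasDerivAt_nonneg
    (f := fun y => log (cosh y) - (y ^ 2 / 2 - y ^ 4 / 12))
    (f' := fun y => tanh y - (y - y ^ 3 / 3))
    (fun y => by
      convert! (hasDerivAt_log_cosh y).sub (((hasDerivAt_pow 2 y).div_const 2).sub
        ((hasDerivAt_pow 4 y).div_const 12)) using 1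
      simp; ring)
    (by simp) (fun y hy => sub_nonneg.2 (self_sub_cube_le_tanh hy)) hx
  beta_reduce at this
  linarith

theorem quartic_sub_sextic_le (x : ℝ) :
    x ^ 4 / 12 - x ^ 6 / 45 ≤ x ^ 2 / 2 - log (cosh x) := by
  wlog hx : 0 ≤ x generalizing x
  · simpa [Even.neg_pow (show Even 4 by decide), Even.neg_pow (show Even 6 by decide)]
      using this (-x) (by linarith)
  have := nonneg_of_hasDerivAt_nonneg
    (f := fun y => (y ^ 2 / 2 - y ^ 4 / 12 + y ^ 6 / 45) - log (cosh y))
    (f' := fun y => (y - y ^ 3 / 3 + 2 * y ^ 5 / 15) - tanh y)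
    (fun y => by
      convert! ((((hasDerivAt_pow 2 y).div_const 2).sub
        ((hasDerivAt_pow 4 y).div_const 12)).add ((hasDerivAt_pow 6 y).div_const 45)).sub
        (hasDerivAt_log_cosh y) using 1
      simp; ring)
    (by simp) (fun y hy => sub_nonneg.2 (tanh_le_quintic hy)) hx
  beta_reduce at this
  linarith

theorem log_cosh_le_sub_half {x : ℝ} (hx : 3 / 2 ≤ x) : log (cosh x) ≤ x - 1 / 2 := by
  rw [log_le_iff_le_exp (cosh_pos x), cosh_eq, sub_eq_add_neg, exp_add]
  have h1 : exp (-x) ≤ exp x * exp (-3) := by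
    rw [← exp_add]; exact exp_le_exp.2 (by linarith)
  have h2 : (1 + exp (-3)) / 2 ≤ exp (-(1 / 2)) := by
    have h3 : exp (-3) ≤ 1 / 8 := by
      rw [show (-3 : ℝ) = (3 : ℕ) * (-1) by norm_num, exp_nat_mul]
      have : exp (-1) ≤ 1 / 2 := by linarith [exp_neg_one_lt_d9]
      calc exp (-1) ^ 3 ≤ (1 / 2) ^ 3 := pow_le_pow_left₀ (exp_pos _).le this 3
        _ = 1 / 8 := by norm_num
    -- Here `9/16 = (1 + 1/8) / 2`, and `(9/16)² < 0.36 < exp (-1)`.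
    have h4 : (9 / 16 : ℝ) ≤ exp (-(1 / 2)) := by
      have h5 : exp (-(1 / 2)) ^ 2 = exp (-1) := by rw [← exp_nat_mul]; norm_num
      have h6 : (0.36 : ℝ) < exp (-1) := by linarith [exp_neg_one_gt_d9]
      by_contra h7
      push Not at h7
      have := pow_lt_pow_left₀ h7 (exp_pos _).le two_ne_zero
      nlinarith
    linarith
  nlinarith [exp_pos x]

/-- This global bound supplies the domination. Up to `3/2`, `1/12 - x²/45 ≥ 1/30`; beyond it, `(x -
1)² / 2 ≥ x² / 18`. Both are equalities at `3/2`. -/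
theorem min_le_half_sq_sub_log_cosh (x : ℝ) :
    min (x ^ 4 / 30) (x ^ 2 / 18) ≤ x ^ 2 / 2 - log (cosh x) := by
  wlog hx : 0 ≤ x generalizing x
  · simpa [Even.neg_pow (show Even 4 by decide)] using this (-x) (by linarith)
  rcases le_or_gt x (3 / 2) with h | h
  · refine (min_le_left _ _).trans (le_trans ?_ (quartic_sub_sextic_le x))
    have : x ^ 2 ≤ 9 / 4 := by nlinarith
    have h4 : 0 ≤ x ^ 4 := by positivity
    nlinarith
  · refine (min_le_right _ _).trans ?_
    have := log_cosh_le_sub_half h.le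
    nlinarith

end Real

/-! ### Independent spins in an external field -/

noncomputable section

namespace CurieWeiss

/-- The law of a single spin in the external field `y`. -/
def spinWeight (y : ℝ) (s : ℤˣ) : ℝ := Real.exp (y * ((s : ℤ) : ℝ)) / (2 * Real.cosh y)

/-- The law of a group of independent spins in the external field `y`. -/
def groupWeight (y : ℝ) {n : ℕ} (x : Fin n → ℤˣ) : ℝ := ∏ i, spinWeight y (x i)

/-- The law of independent spins in the external field `y`. -/
def fieldWeight (y : ℝ) {M : ℕ} {N : Fin M → ℕ} (x : Config N) : ℝ := ∏ ν, groupWeight y (x ν)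

theorem spinWeight_nonneg (y : ℝ) (s : ℤˣ) : 0 ≤ spinWeight y s :=
  div_nonneg (Real.exp_pos _).le (by linarith [Real.cosh_pos y])

theorem groupWeight_nonneg (y : ℝ) {n : ℕ} (x : Fin n → ℤˣ) : 0 ≤ groupWeight y x :=
  Finset.prod_nonneg fun _ _ => spinWeight_nonneg y _

theorem fieldWeight_nonneg (y : ℝ) {M : ℕ} {N : Fin M → ℕ} (x : Config N) : 0 ≤ fieldWeight y x :=
  Finset.prod_nonneg fun _ _ => groupWeight_nonneg y _

theorem sum_int_units {A : Type*} [AddCommMonoid A] (f : ℤˣ → A) : ∑ s, f s = f 1 + f (-1) := by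
  rw [show (Finset.univ : Finset ℤˣ) = {1, -1} from rfl, Finset.sum_pair (by decide)]

theorem sum_spinWeight (y : ℝ) : ∑ s, spinWeight y s = 1 := by
  have := (Real.cosh_pos y).ne'
  rw [sum_int_units, spinWeight, spinWeight]
  simp only [Units.val_one, Int.cast_one, mul_one, Units.val_neg, Int.cast_neg, mul_neg]
  rw [← add_div, div_eq_one_iff_eq (by simpa using this), Real.cosh_eq]
  ring

theorem sum_spinWeight_mul (y : ℝ) :
    ∑ s : ℤˣ, spinWeight y s * (((s : ℤ) : ℝ) - Real.tanh y) = 0 := by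
  have h := sum_spinWeight y
  have := (Real.cosh_pos y).ne'
  simp only [mul_sub, Finset.sum_sub_distrib, ← Finset.sum_mul, h, one_mul]
  rw [sum_int_units, spinWeight, spinWeight, Real.tanh_eq_sinh_div_cosh, Real.sinh_eq]
  simp only [Units.val_one, Int.cast_one, mul_one, Units.val_neg, Int.cast_neg, mul_neg]
  field_simp
  ring

theorem sum_spinWeight_mul_sq_le (y : ℝ) :
    ∑ s : ℤˣ, spinWeight y s * (((s : ℤ) : ℝ) - Real.tanh y) ^ 2 ≤ 1 := by
  have h := sum_spinWeight y
  have h1 := sum_spinWeight_mul y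
  rw [sum_int_units] at *
  simp only [Units.val_one, Int.cast_one, Units.val_neg, Int.cast_neg] at *
  nlinarith [sq_nonneg (Real.tanh y)]

theorem sum_groupWeight (y : ℝ) (n : ℕ) : ∑ x : Fin n → ℤˣ, groupWeight y x = 1 := by
  have := Finset.prod_univ_sum (fun _ : Fin n => (Finset.univ : Finset ℤˣ))
    (fun _ s => spinWeight y s)
  simp only [sum_spinWeight, Finset.prod_const_one, Fintype.piFinset_univ] at this
  exact this.symm

theorem sum_fieldWeight (y : ℝ) {M : ℕ} (N : Fin M → ℕ) :
    ∑ x : Config N, fieldWeight y x = 1 := by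
  have := Finset.prod_univ_sum (fun ν : Fin M => (Finset.univ : Finset (Fin (N ν) → ℤˣ)))
    (fun _ x => groupWeight y x)
  simp only [sum_groupWeight, Finset.prod_const_one, Fintype.piFinset_univ] at this
  exact this.symm

theorem sum_groupWeight_succ (y : ℝ) (n : ℕ) (f : (Fin (n + 1) → ℤˣ) → ℝ) :
    ∑ x : Fin (n + 1) → ℤˣ, groupWeight y x * f x =
      ∑ s : ℤˣ, ∑ x : Fin n → ℤˣ, spinWeight y s * groupWeight y x *
        f (Fin.cons (α := fun _ => ℤˣ) s x) := by
  rw [← (Fin.consEquiv (fun _ : Fin (n + 1) => ℤˣ)).sum_comp, Fintype.sum_prod_type]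
  simp [groupWeight, Fin.consEquiv, Fin.prod_univ_succ]

/-- The deviation of the sum of the spins of a group from its mean in the external field `y`. -/
def deviation (y : ℝ) {n : ℕ} (x : Fin n → ℤˣ) : ℝ :=
  ∑ i, (((x i : ℤ) : ℝ) - Real.tanh y)

theorem deviation_cons (y : ℝ) {n : ℕ} (s : ℤˣ) (x : Fin n → ℤˣ) :
    deviation y (Fin.cons (α := fun _ => ℤˣ) s x : Fin (n + 1) → ℤˣ) =
      (((s : ℤ) : ℝ) - Real.tanh y) + deviation y x := by
  simp [deviation, Fin.sum_univ_succ]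
  ring

theorem sum_groupWeight_mul_deviation (y : ℝ) (n : ℕ) :
    ∑ x : Fin n → ℤˣ, groupWeight y x * deviation y x = 0 := by
  induction n with
  | zero => simp [deviation]
  | succ n ih =>
    rw [sum_groupWeight_succ]
    simp only [deviation_cons, mul_add, Finset.sum_add_distrib]
    have h1 := sum_spinWeight_mul y
    have h2 := sum_groupWeight y n
    simp only [mul_assoc, mul_comm (groupWeight y _) (_ - _)]
    simp only [← Finset.mul_sum, ih, h2, mul_one, mul_zero, Finset.sum_const_zero, add_zero, h1]

/-- Variances of independent spins add: on splitting off one spin the cross term vanishes, as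
deviations have mean zero, and each spin contributes at most `1`. -/
theorem sum_groupWeight_mul_deviation_sq_le (y : ℝ) (n : ℕ) :
    ∑ x : Fin n → ℤˣ, groupWeight y x * deviation y x ^ 2 ≤ n := by
  induction n with
  | zero => simp [deviation]
  | succ n ih =>
    rw [sum_groupWeight_succ]
    have h0 := sum_spinWeight y
    have h1 := sum_spinWeight_mul y
    have h2 := sum_groupWeight y n
    have h3 := sum_groupWeight_mul_deviation y n
    have key : ∀ s : ℤˣ, ∑ x : Fin n → ℤˣ, spinWeight y s * groupWeight y x *
        deviation y (Fin.cons (α := fun _ => ℤˣ) s x : Fin (n + 1) → ℤˣ) ^ 2 =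
        spinWeight y s * (((s : ℤ) : ℝ) - Real.tanh y) ^ 2 +
          spinWeight y s * ∑ x : Fin n → ℤˣ, groupWeight y x * deviation y x ^ 2 := by
      intro s
      set c := ((s : ℤ) : ℝ) - Real.tanh y
      have e : ∀ x : Fin n → ℤˣ, spinWeight y s * groupWeight y x *
          deviation y (Fin.cons (α := fun _ => ℤˣ) s x : Fin (n + 1) → ℤˣ) ^ 2 =
          spinWeight y s * c ^ 2 * groupWeight y x +
          2 * spinWeight y s * c * (groupWeight y x * deviation y x) +
          spinWeight y s * (groupWeight y x * deviation y x ^ 2) := by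
        intro x
        rw [deviation_cons]
        ring
      simp only [e, Finset.sum_add_distrib, ← Finset.mul_sum, h2, h3]
      ring
    simp only [key, Finset.sum_add_distrib, ← Finset.sum_mul, h0]
    have := sum_spinWeight_mul_sq_le y
    push_cast
    linarith

theorem sum_groupWeight_mul_abs_deviation_le (y : ℝ) (n : ℕ) :
    ∑ x : Fin n → ℤˣ, groupWeight y x * |deviation y x| ≤ √n := by
  rcases Nat.eq_zero_or_pos n with rfl | hn
  · simp [deviation]
  have hn' : 0 < √(n : ℝ) := Real.sqrt_pos.2 (by exact_mod_cast hn)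
  have hs : √(n : ℝ) ^ 2 = n := Real.sq_sqrt (Nat.cast_nonneg n)
  have h2 := sum_groupWeight y n
  have h3 := sum_groupWeight_mul_deviation_sq_le y n
  -- Cauchy–Schwarz in the form `2 √n |d| ≤ n + d²`.
  have h4 : ∑ x : Fin n → ℤˣ, groupWeight y x * (2 * √(n : ℝ) * |deviation y x|) ≤
      ∑ x : Fin n → ℤˣ, groupWeight y x * (√(n : ℝ) ^ 2 + deviation y x ^ 2) := by
    refine Finset.sum_le_sum fun x _ => mul_le_mul_of_nonneg_left ?_ (groupWeight_nonneg y x)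
    nlinarith [sq_nonneg (√(n : ℝ) - |deviation y x|), sq_abs (deviation y x)]
  simp only [mul_add, Finset.sum_add_distrib, ← Finset.sum_mul, h2, mul_left_comm (groupWeight y _),
    ← Finset.mul_sum, mul_assoc] at h4
  have : √(n : ℝ) * ∑ x : Fin n → ℤˣ, groupWeight y x * |deviation y x| ≤ √(n : ℝ) * √n := by
    nlinarith
  exact le_of_mul_le_mul_left this hn'

theorem sum_fieldWeight_mul_apply (y : ℝ) {M : ℕ} {N : Fin M → ℕ} (κ : Fin M)
    (h : (Fin (N κ) → ℤˣ) → ℝ) :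
    ∑ x : Config N, fieldWeight y x * h (x κ) = ∑ x, groupWeight y x * h x := by
  -- Padding `h` with factors `1` lets the sum factor over the groups; the groups other than `κ`
  -- have total weight `1`.
  set H : ∀ ν, (Fin (N ν) → ℤˣ) → ℝ := Function.update (fun _ _ => 1) κ h
  have hH : ∀ x : Config N, h (x κ) = ∏ ν, H ν (x ν) := by
    intro x
    rw [Finset.prod_eq_single κ (fun ν _ hν => by simp [H, hν]) (by simp)]
    simp [H]
  have := Finset.prod_univ_sum (fun ν : Fin M => (Finset.univ : Finset (Fin (N ν) → ℤˣ)))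
    (fun ν x => groupWeight y x * H ν x)
  rw [Fintype.piFinset_univ] at this
  simp only [hH, fieldWeight, ← Finset.prod_mul_distrib]
  rw [← this, Finset.prod_eq_single κ (fun ν _ hν => by simp [H, hν, sum_groupWeight]) (by simp)]
  simp [H]

theorem deviation_eq (y : ℝ) {M : ℕ} {N : Fin M → ℕ} (x : Config N) (ν : Fin M) :
    deviation y (x ν) = magnetisation x ν - N ν * Real.tanh y := by
  simp [deviation, magnetisation, spin]

theorem fieldWeight_eq (y : ℝ) {M : ℕ} {N : Fin M → ℕ} (x : Config N) :
    fieldWeight y x =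
      Real.exp (y * ∑ ν, magnetisation x ν) / (2 * Real.cosh y) ^ total N := by
  simp only [fieldWeight, groupWeight, spinWeight, Finset.prod_div_distrib, Finset.prod_const,
    Finset.card_univ, Fintype.card_fin, ← Real.exp_sum, total, Finset.prod_pow_eq_pow_sum,
    magnetisation, spin, Finset.mul_sum]

/-! ### Gaussian linearisation of the Hamiltonian -/

theorem hamiltonian_homogeneousCoupling_one {M : ℕ} (N : Fin M → ℕ) (x : Config N) :
    -hamiltonian (homogeneousCoupling M 1) N x =
      (∑ ν, magnetisation x ν) ^ 2 / (2 * (total N : ℝ)) := by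
  have : (∑ ν, magnetisation x ν) ^ 2 =
      ∑ ν, ∑ κ, ∑ i : Fin (N ν), ∑ j : Fin (N κ), spin x ν i * spin x κ j := by
    simp only [sq, magnetisation, Finset.sum_mul_sum]
  rw [this, hamiltonian]
  simp only [homogeneousCoupling, Matrix.of_apply, one_mul]
  ring

theorem exp_neg_half_mul_sq_add_mul {b : ℝ} (hb : b ≠ 0) (c t : ℝ) :
    Real.exp (-(b * t ^ 2 / 2) + c * t) =
      Real.exp (c ^ 2 / (2 * b)) * Real.exp (-(b / 2) * (t - c / b) ^ 2) := by
  rw [← Real.exp_add]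
  congr 1
  field_simp
  ring

theorem integrable_exp_neg_half_mul_sq_add_mul {b : ℝ} (hb : 0 < b) (c : ℝ) :
    Integrable fun t : ℝ => Real.exp (-(b * t ^ 2 / 2) + c * t) := by
  simp only [exp_neg_half_mul_sq_add_mul hb.ne']
  exact ((integrable_exp_neg_mul_sq (half_pos hb)).comp_sub_right (c / b)).const_mul _

theorem integral_exp_neg_half_mul_sq_add_mul {b : ℝ} (hb : 0 < b) (c : ℝ) :
    ∫ t : ℝ, Real.exp (-(b * t ^ 2 / 2) + c * t) =
      Real.exp (c ^ 2 / (2 * b)) * √(Real.pi / (b / 2)) := by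
  simp only [exp_neg_half_mul_sq_add_mul hb.ne']
  rw [integral_const_mul, integral_sub_right_eq_self (fun t => Real.exp (-(b / 2) * t ^ 2)),
    integral_gaussian]

/-- The scale `n ^ (-1/4)` of the random external field. -/
def fieldScale (n : ℕ) : ℝ := (n : ℝ) ^ (-(1 / 4) : ℝ)

theorem fieldScale_pos {n : ℕ} (hn : 0 < n) : 0 < fieldScale n :=
  Real.rpow_pos_of_pos (by exact_mod_cast hn) _

theorem mul_fieldScale_pow_four {n : ℕ} (hn : 0 < n) : (n : ℝ) * fieldScale n ^ 4 = 1 := by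
  have h : (n : ℝ) ≠ 0 := by exact_mod_cast hn.ne'
  rw [fieldScale, ← Real.rpow_natCast, ← Real.rpow_mul (Nat.cast_nonneg n),
    show (-(1 / 4) * ((4 : ℕ) : ℝ) : ℝ) = -1 by norm_num, Real.rpow_neg_one, mul_inv_cancel₀ h]

theorem fieldScale_le_one {n : ℕ} (hn : 0 < n) : fieldScale n ≤ 1 :=
  Real.rpow_le_one_of_one_le_of_nonpos (by exact_mod_cast hn) (by norm_num)

theorem tendsto_fieldScale : Tendsto fieldScale atTop (𝓝 0) :=
  (tendsto_rpow_neg_atTop (by norm_num)).comp tendsto_natCast_atTop_atTop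

/-- The unnormalised density, in the rescaled variable `t`, of the random external field in which
the spins of the homogeneous model at `β = 1` are independent. -/
def fieldDensity (n : ℕ) (t : ℝ) : ℝ :=
  Real.exp (-(n * ((t * fieldScale n) ^ 2 / 2 - Real.log (Real.cosh (t * fieldScale n)))))

/-- The power of `cosh` in the density cancels the normalisation of the independent spins, leaving a
Gaussian in `t`. -/
theorem fieldDensity_mul_fieldWeight (t : ℝ) {M : ℕ} {N : Fin M → ℕ} (x : Config N) :
    fieldDensity (total N) t * fieldWeight (t * fieldScale (total N)) x =
      (2 ^ total N)⁻¹ * Real.exp (-(total N * fieldScale (total N) ^ 2 * t ^ 2 / 2) +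
        (fieldScale (total N) * ∑ ν, magnetisation x ν) * t) := by
  rw [fieldWeight_eq]
  set n := total N
  set s := fieldScale n
  have hc := Real.cosh_pos (t * s)
  have h : fieldDensity n t =
      Real.exp (-(n * s ^ 2 * t ^ 2 / 2)) * Real.cosh (t * s) ^ n := by
    conv_rhs => rw [← Real.exp_log hc, ← Real.exp_nat_mul, ← Real.exp_add]
    rw [fieldDensity]
    congr 1
    ring
  rw [h, Real.exp_add, mul_pow]
  have := pow_ne_zero n hc.ne'
  rw [show t * s * ∑ ν, magnetisation x ν = s * (∑ ν, magnetisation x ν) * t by ring]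
  field_simp

/-- Completing the square recovers `exp (S² / 2n)`. It matters that `C` is independent of `F`: it
cancels in expectations. -/
theorem exists_pos_sum_exp_neg_hamiltonian {M : ℕ} (N : Fin M → ℕ) (hN : 0 < total N) :
    ∃ C : ℝ, 0 < C ∧ ∀ F : Config N → ℝ,
      ∫ t, fieldDensity (total N) t *
          ∑ x, fieldWeight (t * fieldScale (total N)) x * F x =
        C * ∑ x, Real.exp (-hamiltonian (homogeneousCoupling M 1) N x) * F x := by
  have hn : (0 : ℝ) < total N := by exact_mod_cast hN
  have hs := fieldScale_pos hN
  have hb : 0 < (total N : ℝ) * fieldScale (total N) ^ 2 := by positivity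
  refine ⟨(2 ^ total N)⁻¹ * √(Real.pi / ((total N : ℝ) * fieldScale (total N) ^ 2 / 2)),
    mul_pos (by positivity) (Real.sqrt_pos.2 (div_pos Real.pi_pos (by positivity))), fun F => ?_⟩
  simp only [Finset.mul_sum]
  have e : ∀ (x : Config N) (t : ℝ), fieldDensity (total N) t *
      (fieldWeight (t * fieldScale (total N)) x * F x) =
      (2 ^ total N)⁻¹ * F x *
        Real.exp (-(total N * fieldScale (total N) ^ 2 * t ^ 2 / 2) +
          (fieldScale (total N) * ∑ ν, magnetisation x ν) * t) := by
    intro x t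
    rw [← mul_assoc, fieldDensity_mul_fieldWeight]
    ring
  simp only [e]
  rw [integral_finsetSum _ fun x _ =>
    (integrable_exp_neg_half_mul_sq_add_mul hb _).const_mul _]
  refine Finset.sum_congr rfl fun x _ => ?_
  rw [integral_const_mul, integral_exp_neg_half_mul_sq_add_mul hb,
    hamiltonian_homogeneousCoupling_one]
  have h2 : (fieldScale (total N) * ∑ ν, magnetisation x ν) ^ 2 /
      (2 * (total N * fieldScale (total N) ^ 2)) =
      (∑ ν, magnetisation x ν) ^ 2 / (2 * (total N : ℝ)) := by
    field_simp
  rw [h2]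
  ring

theorem integral_normalisedLaw {M : ℕ} (J : Matrix (Fin M) (Fin M) ℝ) (γ : ℝ) (N : Fin M → ℕ)
    {f : (Fin M → ℝ) → ℝ} (hf : Measurable f) :
    ∫ x, f x ∂(normalisedLaw J γ N : Measure (Fin M → ℝ)) =
      (∑ x : Config N, Real.exp (-hamiltonian J N x) * f (normalisedMagnetisation γ x)) /
        ∑ x : Config N, Real.exp (-hamiltonian J N x) := by
  let _ : MeasurableSpace (Config N) := ⊤
  have _ : MeasurableSingletonClass (Config N) := ⟨fun _ => trivial⟩
  have hm : Measurable (normalisedMagnetisation γ : Config N → Fin M → ℝ) := fun _ _ => trivial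
  change ∫ x, f x ∂((canonicalEnsemble J N).map (normalisedMagnetisation γ)).toMeasure = _
  rw [← PMF.toMeasure_map (hf := hm), integral_map hm.aemeasurable hf.aestronglyMeasurable,
    PMF.integral_eq_sum, Finset.sum_div]
  refine Finset.sum_congr rfl fun x _ => ?_
  have : ((canonicalEnsemble J N) x).toReal =
      (partitionFunction J N)⁻¹ * Real.exp (-hamiltonian J N x) :=
    ENNReal.toReal_ofReal
      (mul_nonneg (inv_nonneg.2 (partitionFunction_pos J N).le) (Real.exp_pos _).le)
  rw [this, smul_eq_mul, partitionFunction]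
  ring

theorem integral_normalisedLaw_eq_field {M : ℕ} (γ : ℝ) (N : Fin M → ℕ) (hN : 0 < total N)
    {f : (Fin M → ℝ) → ℝ} (hf : Measurable f) :
    ∫ x, f x ∂(normalisedLaw (homogeneousCoupling M 1) γ N : Measure (Fin M → ℝ)) =
      (∫ t, fieldDensity (total N) t * ∑ x : Config N,
        fieldWeight (t * fieldScale (total N)) x * f (normalisedMagnetisation γ x)) /
        ∫ t, fieldDensity (total N) t := by
  obtain ⟨C, hC, h⟩ := exists_pos_sum_exp_neg_hamiltonian N hN
  -- The choice `F = 1` identifies the denominator.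
  have h1 := h fun _ => 1
  simp only [mul_one, sum_fieldWeight] at h1
  rw [integral_normalisedLaw _ _ _ hf, h, h1, mul_div_mul_left _ _ hC.ne']

/-! ### Asymptotics of the random field -/

/-- With `s = n ^ (-1/4)`, `n s⁴ = 1` and `n s² ≥ 1` turn the two alternatives of the global bound
into a majorant free of `n`. -/
theorem fieldDensity_le {n : ℕ} (hn : 0 < n) (t : ℝ) :
    fieldDensity n t ≤ Real.exp (-(1 / 30) * t ^ 4) + Real.exp (-(1 / 18) * t ^ 2) := by
  have hs := fieldScale_pos hn
  have h4 := mul_fieldScale_pow_four hn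
  have h1 := fieldScale_le_one hn
  have hn' : (0 : ℝ) < n := by exact_mod_cast hn
  have h2 : 1 ≤ (n : ℝ) * fieldScale n ^ 2 := by
    rw [← h4]
    exact mul_le_mul_of_nonneg_left (pow_le_pow_of_le_one hs.le h1 (by norm_num)) hn'.le
  have h := Real.min_le_half_sq_sub_log_cosh (t * fieldScale n)
  rw [fieldDensity]
  rcases min_le_iff.1 h with h | h
  · refine le_add_of_le_of_nonneg (Real.exp_le_exp.2 ?_) (Real.exp_pos _).le
    have := mul_le_mul_of_nonneg_left h hn'.le
    have e : (n : ℝ) * ((t * fieldScale n) ^ 4 / 30) = t ^ 4 / 30 * (n * fieldScale n ^ 4) := by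
      ring
    rw [e, h4] at this
    linarith
  · refine le_add_of_nonneg_of_le (Real.exp_pos _).le (Real.exp_le_exp.2 ?_)
    have := mul_le_mul_of_nonneg_left h hn'.le
    have e : (n : ℝ) * ((t * fieldScale n) ^ 2 / 18) = t ^ 2 / 18 * (n * fieldScale n ^ 2) := by
      ring
    rw [e] at this
    nlinarith [sq_nonneg t]

/-- The quartic and sextic bounds squeeze the exponent, with error at most `t⁶ s² / 45` for `s =
fieldScale n`. -/
theorem tendsto_fieldDensity (t : ℝ) :
    Tendsto (fun n => fieldDensity n t) atTop (𝓝 (Real.exp (-(1 / 12) * t ^ 4))) := by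
  refine (Real.continuous_exp.tendsto _).comp ?_
  have hl : Tendsto (fun n => -(1 / 12) * t ^ 4 + t ^ 6 / 45 * fieldScale n ^ 2) atTop
      (𝓝 (-(1 / 12) * t ^ 4)) := by
    have h := ((tendsto_fieldScale.pow 2).const_mul (t ^ 6 / 45)).const_add (-(1 / 12) * t ^ 4)
    rwa [zero_pow two_ne_zero, mul_zero, add_zero] at h
  refine tendsto_of_tendsto_of_tendsto_of_le_of_le' tendsto_const_nhds hl ?_ ?_
  · filter_upwards [eventually_gt_atTop 0] with n hn
    have h := mul_le_mul_of_nonneg_left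
      (Real.half_sq_sub_log_cosh_le (t * fieldScale n)) (Nat.cast_nonneg (α := ℝ) n)
    have e : (n : ℝ) * ((t * fieldScale n) ^ 4 / 12) = t ^ 4 / 12 * (n * fieldScale n ^ 4) := by
      ring
    rw [e, mul_fieldScale_pow_four hn] at h
    linarith
  · filter_upwards [eventually_gt_atTop 0] with n hn
    have h := mul_le_mul_of_nonneg_left
      (Real.quartic_sub_sextic_le (t * fieldScale n)) (Nat.cast_nonneg (α := ℝ) n)
    have e : (n : ℝ) * ((t * fieldScale n) ^ 4 / 12 - (t * fieldScale n) ^ 6 / 45) =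
        (t ^ 4 / 12 - t ^ 6 / 45 * fieldScale n ^ 2) * (n * fieldScale n ^ 4) := by
      ring
    rw [e, mul_fieldScale_pow_four hn] at h
    linarith

theorem continuous_fieldDensity (n : ℕ) : Continuous (fieldDensity n) := by
  unfold fieldDensity
  refine Real.continuous_exp.comp ?_
  have : Continuous fun t : ℝ => Real.log (Real.cosh (t * fieldScale n)) :=
    (Real.continuous_cosh.comp (by fun_prop)).log fun _ => (Real.cosh_pos _).ne'
  fun_prop

theorem continuous_fieldWeight {M : ℕ} {N : Fin M → ℕ} (x : Config N) :
    Continuous fun y => fieldWeight y x := by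
  simp only [fieldWeight_eq]
  exact Continuous.div (by fun_prop)
    ((continuous_const.mul Real.continuous_cosh).pow _)
    fun y => pow_ne_zero _ (mul_pos two_pos (Real.cosh_pos y)).ne'

theorem integrable_exp_neg_mul_pow_four {b : ℝ} (hb : 0 < b) :
    Integrable fun t : ℝ => Real.exp (-b * t ^ 4) := by
  simpa [Even.pow_abs (show Even 4 by decide)] using
    integrable_abs_pow_mul_exp_neg 0 4 (by norm_num) hb

theorem tendsto_integral_fieldDensity_mul {n : ℕ → ℕ} (hn : Tendsto n atTop atTop)
    {G : ℕ → ℝ → ℝ} {g : ℝ → ℝ} {C : ℝ} (hG : ∀ k, Continuous (G k))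
    (hC : ∀ k t, |G k t| ≤ C) (hg : ∀ t, Tendsto (fun k => G k t) atTop (𝓝 (g t))) :
    Tendsto (fun k => ∫ t, fieldDensity (n k) t * G k t) atTop
      (𝓝 (∫ t, Real.exp (-(1 / 12) * t ^ 4) * g t)) := by
  refine tendsto_integral_filter_of_dominated_convergence
    (fun t => (Real.exp (-(1 / 30) * t ^ 4) + Real.exp (-(1 / 18) * t ^ 2)) * C) ?_ ?_ ?_ ?_
  · exact .of_forall fun k => ((continuous_fieldDensity _).mul (hG k)).aestronglyMeasurable
  · filter_upwards [hn.eventually_gt_atTop 0] with k hk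
    refine .of_forall fun t => ?_
    rw [Real.norm_eq_abs, abs_mul, abs_of_pos (show 0 < fieldDensity (n k) t from Real.exp_pos _)]
    exact mul_le_mul (fieldDensity_le hk t) (hC k t) (abs_nonneg _) (by positivity)
  · exact ((integrable_exp_neg_mul_pow_four (by norm_num)).add
      (integrable_exp_neg_mul_sq (by norm_num))).mul_const _
  · exact .of_forall fun t => ((tendsto_fieldDensity t).comp hn).mul (hg t)

/-! ### The quartic law and its image on a line -/

/-- The normalisation constant of the density `exp (-t ^ 4 / 12)`. -/
def quarticConst : ℝ := ∫ t : ℝ, Real.exp (-(1 / 12) * t ^ 4)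

theorem quarticConst_eq :
    quarticConst = 2 * ((12 : ℝ) ^ (1 / 4 : ℝ) * (1 / 4) * Real.Gamma (1 / 4)) := by
  have h := integral_abs_pow_mul_exp_neg 0 4 (by norm_num) (b := 1 / 12) (by norm_num)
  simp only [pow_zero, one_mul, Even.pow_abs (show Even 4 by decide)] at h
  rw [quarticConst, h, one_div (12 : ℝ), Real.inv_rpow (by norm_num), ← Real.rpow_neg (by norm_num)]
  norm_num

theorem quarticConst_pos : 0 < quarticConst := by
  rw [quarticConst_eq]
  have := Real.Gamma_pos_of_pos (show (0 : ℝ) < 1 / 4 by norm_num)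
  positivity

/-- The probability measure on `ℝ` with density proportional to `exp (-t ^ 4 / 12)`. -/
def quarticMeasure : Measure ℝ :=
  volume.withDensity fun t => ENNReal.ofReal (Real.exp (-(1 / 12) * t ^ 4) / quarticConst)

theorem integral_quarticMeasure (f : ℝ → ℝ) :
    ∫ t, f t ∂quarticMeasure =
      (∫ t : ℝ, Real.exp (-(1 / 12) * t ^ 4) * f t) / quarticConst := by
  rw [quarticMeasure, integral_withDensity_eq_integral_toReal_smul (by fun_prop) (by simp),
    ← integral_div]
  refine integral_congr_ae (.of_forall fun t => ?_)
  simp only [smul_eq_mul]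
  rw [ENNReal.toReal_ofReal (div_nonneg (Real.exp_pos _).le quarticConst_pos.le)]
  ring

instance : IsProbabilityMeasure quarticMeasure := by
  constructor
  rw [quarticMeasure, withDensity_apply _ MeasurableSet.univ, Measure.restrict_univ,
    ← ofReal_integral_eq_lintegral_ofReal
      ((integrable_exp_neg_mul_pow_four (by norm_num)).div_const _)
      (.of_forall fun t => div_nonneg (Real.exp_pos _).le quarticConst_pos.le),
    integral_div]
  change ENNReal.ofReal (quarticConst / quarticConst) = 1
  rw [div_self quarticConst_pos.ne', ENNReal.ofReal_one]

theorem integrable_pow_quarticMeasure (k : ℕ) : Integrable (fun t => t ^ k) quarticMeasure := by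
  rw [quarticMeasure, integrable_withDensity_iff_integrable_smul' (by fun_prop) (by simp)]
  have h := ((integrable_abs_pow_mul_exp_neg k 4 (by norm_num) (b := 1 / 12)
    (by norm_num)).div_const quarticConst)
  refine h.mono' (by fun_prop) (.of_forall fun t => le_of_eq ?_)
  rw [ENNReal.toReal_ofReal (div_nonneg (Real.exp_pos _).le quarticConst_pos.le), norm_smul,
    Real.norm_eq_abs, Real.norm_eq_abs, abs_div, abs_of_pos quarticConst_pos, Real.abs_exp,
    abs_pow, Even.pow_abs (show Even 4 by decide)]
  ring

theorem integral_pow_quarticMeasure_of_even {k : ℕ} (hk : Even k) :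
    ∫ t, t ^ k ∂quarticMeasure =
      (12 : ℝ) ^ ((k : ℝ) / 4) * (Real.Gamma (((k : ℝ) + 1) / 4) / Real.Gamma (1 / 4)) := by
  have h := integral_abs_pow_mul_exp_neg k 4 (by norm_num) (b := 1 / 12) (by norm_num)
  simp only [hk.pow_abs, Even.pow_abs (show Even 4 by decide)] at h
  simp only [mul_comm (_ ^ k)] at h
  rw [integral_quarticMeasure, h, quarticConst_eq, one_div (12 : ℝ),
    Real.inv_rpow (by norm_num), ← Real.rpow_neg (by norm_num),
    show -(-((k : ℝ) + 1) / ((4 : ℕ) : ℝ)) = k / 4 + 1 / 4 by push_cast; ring,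
    Real.rpow_add (by norm_num)]
  have h1 := (Real.Gamma_pos_of_pos (show (0 : ℝ) < 1 / 4 by norm_num)).ne'
  have h2 : (12 : ℝ) ^ (1 / 4 : ℝ) ≠ 0 := by positivity
  push_cast
  field_simp

theorem integral_pow_quarticMeasure_of_odd {k : ℕ} (hk : Odd k) :
    ∫ t, t ^ k ∂quarticMeasure = 0 := by
  have h := integral_neg_eq_self (fun t : ℝ => Real.exp (-(1 / 12) * t ^ 4) * t ^ k) volume
  simp only [hk.neg_pow, Even.neg_pow (show Even 4 by decide), mul_neg, integral_neg] at h
  rw [integral_quarticMeasure, show (∫ t : ℝ, Real.exp (-(1 / 12) * t ^ 4) * t ^ k) = 0 by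
    simp only [neg_mul] at h ⊢; linarith, zero_div]

/-- The line in `ℝ ^ M` that carries the limit law. -/
def limitLine {M : ℕ} (α : Fin M → ℝ) (t : ℝ) : Fin M → ℝ := fun ν => α ν ^ (1 / 4 : ℝ) * t

theorem continuous_limitLine {M : ℕ} (α : Fin M → ℝ) : Continuous (limitLine α) := by
  unfold limitLine
  fun_prop

/-- The limit law of the magnetisations of the homogeneous model at `β = 1`. -/
def limitLaw {M : ℕ} (α : Fin M → ℝ) : ProbabilityMeasure (Fin M → ℝ) :=
  ⟨quarticMeasure.map (limitLine α),
    Measure.isProbabilityMeasure_map (continuous_limitLine α).aemeasurable⟩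

theorem integral_limitLaw {M : ℕ} (α : Fin M → ℝ) {f : (Fin M → ℝ) → ℝ} (hf : Continuous f) :
    ∫ x, f x ∂(limitLaw α : Measure (Fin M → ℝ)) = ∫ t, f (limitLine α t) ∂quarticMeasure :=
  integral_map (continuous_limitLine α).aemeasurable hf.aestronglyMeasurable

theorem prod_limitLine_pow {M : ℕ} {α : Fin M → ℝ} (hα : ∀ ν, 0 ≤ α ν) (K : Fin M → ℕ) (t : ℝ) :
    ∏ ν, limitLine α t ν ^ K ν = t ^ (∑ ν, K ν) * ∏ ν, α ν ^ ((K ν : ℝ) / 4) := by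
  simp only [limitLine, mul_pow, Finset.prod_mul_distrib, Finset.prod_pow_eq_pow_sum]
  rw [mul_comm]
  congr 1
  refine Finset.prod_congr rfl fun ν _ => ?_
  -- Nonnegativity is enough here, so `α ν = 0` is covered, with `0 ^ 0 = 1`.
  rw [← Real.rpow_natCast, ← Real.rpow_mul (hα ν)]
  congr 1
  ring

theorem integrable_prod_pow_limitLaw {M : ℕ} {α : Fin M → ℝ} (hα : ∀ ν, 0 ≤ α ν)
    (K : Fin M → ℕ) :
    Integrable (fun x : Fin M → ℝ => ∏ ν, x ν ^ K ν) (limitLaw α : Measure (Fin M → ℝ)) := by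
  refine (integrable_map_measure (Continuous.aestronglyMeasurable (by fun_prop))
    (continuous_limitLine α).aemeasurable).2 ?_
  have e : (fun x : Fin M → ℝ => ∏ ν, x ν ^ K ν) ∘ limitLine α =
      fun t => t ^ (∑ ν, K ν) * ∏ ν, α ν ^ ((K ν : ℝ) / 4) :=
    funext (prod_limitLine_pow hα K)
  rw [e]
  exact (integrable_pow_quarticMeasure _).mul_const _

theorem integral_prod_pow_limitLaw {M : ℕ} {α : Fin M → ℝ} (hα : ∀ ν, 0 ≤ α ν)
    (K : Fin M → ℕ) :
    ∫ x : Fin M → ℝ, ∏ ν, x ν ^ K ν ∂(limitLaw α : Measure (Fin M → ℝ)) =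
      (∫ t, t ^ (∑ ν, K ν) ∂quarticMeasure) * ∏ ν, α ν ^ ((K ν : ℝ) / 4) := by
  rw [integral_limitLaw α (by fun_prop)]
  simp only [prod_limitLine_pow hα]
  rw [integral_mul_const]

/-! ### Concentration given the field, and weak convergence -/

/-- The mean of the normalised magnetisations of independent spins in the external field `y`. -/
def fieldMean {M : ℕ} (y : ℝ) (N : Fin M → ℕ) : Fin M → ℝ :=
  fun ν => N ν * Real.tanh y / (N ν : ℝ) ^ (3 / 4 : ℝ)

theorem abs_sum_fieldWeight_sub_le {M : ℕ} (N : Fin M → ℕ) (y : ℝ) {f : (Fin M → ℝ) → ℝ}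
    {L : NNReal} (hf : LipschitzWith L f) :
    |∑ x : Config N, fieldWeight y x * f (normalisedMagnetisation (3 / 4) x) -
      f (fieldMean y N)| ≤ L * ∑ ν, √(N ν : ℝ) / (N ν : ℝ) ^ (3 / 4 : ℝ) := by
  have e : f (fieldMean y N) = ∑ x : Config N, fieldWeight y x * f (fieldMean y N) := by
    rw [← Finset.sum_mul, sum_fieldWeight, one_mul]
  rw [e, ← Finset.sum_sub_distrib]
  calc _ ≤ ∑ x : Config N, |fieldWeight y x * f (normalisedMagnetisation (3 / 4) x) -
        fieldWeight y x * f (fieldMean y N)| := Finset.abs_sum_le_sum_abs _ _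
    _ ≤ ∑ x : Config N, fieldWeight y x *
        (L * ∑ ν, |deviation y (x ν)| / (N ν : ℝ) ^ (3 / 4 : ℝ)) := by
      refine Finset.sum_le_sum fun x _ => ?_
      rw [← mul_sub, abs_mul, abs_of_nonneg (fieldWeight_nonneg y x)]
      refine mul_le_mul_of_nonneg_left ?_ (fieldWeight_nonneg y x)
      refine (hf.dist_le_mul _ _).trans (mul_le_mul_of_nonneg_left ?_ L.coe_nonneg)
      have hnn : ∀ ν, 0 ≤ |deviation y (x ν)| / (N ν : ℝ) ^ (3 / 4 : ℝ) := fun ν => by positivity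
      -- The sup distance is bounded by the sum over the coordinates, so that each group can be
      -- averaged separately.
      refine (dist_pi_le_iff (Finset.sum_nonneg fun ν _ => hnn ν)).2 fun ν => ?_
      refine le_trans (le_of_eq ?_)
        (Finset.single_le_sum (fun ν _ => hnn ν) (Finset.mem_univ ν))
      rw [deviation_eq, Real.dist_eq, normalisedMagnetisation, fieldMean, ← sub_div, abs_div,
        abs_of_nonneg (Real.rpow_nonneg (Nat.cast_nonneg (N ν)) _)]
    _ = L * ∑ ν, (∑ x : Fin (N ν) → ℤˣ, groupWeight y x * |deviation y x|) /
          (N ν : ℝ) ^ (3 / 4 : ℝ) := by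
      simp only [← sum_fieldWeight_mul_apply y _ fun x => |deviation y x|, Finset.sum_div,
        Finset.mul_sum]
      rw [Finset.sum_comm]
      exact Finset.sum_congr rfl fun ν _ => Finset.sum_congr rfl fun x _ => by ring
    _ ≤ _ := by
      refine mul_le_mul_of_nonneg_left (Finset.sum_le_sum fun ν _ => ?_) L.coe_nonneg
      exact div_le_div_of_nonneg_right (sum_groupWeight_mul_abs_deviation_le y _) (by positivity)

theorem tendsto_tanh_div_fieldScale (t : ℝ) :
    Tendsto (fun n => Real.tanh (t * fieldScale n) / fieldScale n) atTop (𝓝 t) := by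
  rw [tendsto_iff_norm_sub_tendsto_zero]
  have h : Tendsto (fun n => |t| ^ 3 / 3 * fieldScale n ^ 2) atTop (𝓝 0) := by
    simpa using (tendsto_fieldScale.pow 2).const_mul (|t| ^ 3 / 3)
  refine squeeze_zero' (.of_forall fun _ => norm_nonneg _) ?_ h
  filter_upwards [eventually_gt_atTop 0] with n hn
  have hs := fieldScale_pos hn
  have := Real.abs_tanh_sub_self_le (t * fieldScale n)
  rw [Real.norm_eq_abs, show Real.tanh (t * fieldScale n) / fieldScale n - t =
    (Real.tanh (t * fieldScale n) - t * fieldScale n) / fieldScale n by field_simp, abs_div,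
    abs_of_pos hs, div_le_iff₀ hs]
  rw [abs_mul, abs_of_pos hs] at this
  linarith

/-- Separates the group proportion, which tends to `α ν`, from a factor common to all groups, which
tends to `t` when `y = t * fieldScale (total N)`. -/
theorem fieldMean_apply {M : ℕ} (y : ℝ) {N : Fin M → ℕ} {ν : Fin M} (hν : 0 < N ν) :
    fieldMean y N ν = ((N ν : ℝ) / total N) ^ (1 / 4 : ℝ) *
      (Real.tanh y / fieldScale (total N)) := by
  have h1 : (0 : ℝ) < N ν := by exact_mod_cast hν
  have h2 : (0 : ℝ) < total N := by
    exact_mod_cast hν.trans_le (Finset.single_le_sum (fun _ _ => Nat.zero_le _) (Finset.mem_univ ν))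
  have h3 : (N ν : ℝ) = (N ν : ℝ) ^ (1 / 4 : ℝ) * (N ν : ℝ) ^ (3 / 4 : ℝ) := by
    rw [← Real.rpow_add h1]; norm_num
  rw [fieldMean, Real.div_rpow h1.le h2.le, fieldScale, Real.rpow_neg h2.le]
  have h4 := (Real.rpow_pos_of_pos h1 (3 / 4)).ne'
  have h5 := (Real.rpow_pos_of_pos h2 (1 / 4)).ne'
  rw [div_inv_eq_mul, div_eq_iff h4]
  nth_rewrite 1 [h3]
  field_simp

theorem tendsto_sqrt_div_rpow :
    Tendsto (fun n : ℕ => √(n : ℝ) / (n : ℝ) ^ (3 / 4 : ℝ)) atTop (𝓝 0) := by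
  refine tendsto_fieldScale.congr' ?_
  filter_upwards [eventually_gt_atTop 0] with n hn
  rw [fieldScale, Real.sqrt_eq_rpow, ← Real.rpow_sub (by exact_mod_cast hn)]
  norm_num

theorem tendsto_fieldMean {M : ℕ} {α : Fin M → ℝ} {N : ℕ → Fin M → ℕ}
    (hN : ∀ ν, Tendsto (fun n => N n ν) atTop atTop)
    (hT : Tendsto (fun n => total (N n)) atTop atTop)
    (hα : ∀ ν, Tendsto (fun n => (N n ν : ℝ) / (total (N n) : ℝ)) atTop (𝓝 (α ν))) (t : ℝ) :
    Tendsto (fun n => fieldMean (t * fieldScale (total (N n))) (N n)) atTop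
      (𝓝 (limitLine α t)) := by
  refine tendsto_pi_nhds.2 fun ν => ?_
  have h := ((hα ν).rpow_const (p := 1 / 4) (Or.inr (by norm_num))).mul
    ((tendsto_tanh_div_fieldScale t).comp hT)
  refine h.congr' ?_
  filter_upwards [(hN ν).eventually_gt_atTop 0] with n hn
  rw [fieldMean_apply _ hn]
  rfl

theorem tendsto_normalisedLaw {M : ℕ} {α : Fin M → ℝ} {N : ℕ → Fin M → ℕ}
    (hN : ∀ ν, Tendsto (fun n => N n ν) atTop atTop)
    (hT : Tendsto (fun n => total (N n)) atTop atTop)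
    (hα : ∀ ν, Tendsto (fun n => (N n ν : ℝ) / (total (N n) : ℝ)) atTop (𝓝 (α ν))) :
    Tendsto (fun n => normalisedLaw (homogeneousCoupling M 1) (3 / 4) (N n)) atTop
      (𝓝 (limitLaw α)) := by
  -- Bounded Lipschitz test functions suffice; the Lipschitz constant converts mean deviations into
  -- an error bound.
  rw [tendsto_iff_forall_lipschitz_integral_tendsto]
  rintro f ⟨C, hC⟩ ⟨L, hL⟩
  have hbd : ∀ x, |f x| ≤ |f 0| + C := fun x => by
    have h1 := hC x 0
    rw [Real.dist_eq] at h1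
    linarith [abs_sub_abs_le_abs_sub (f x) (f 0)]
  set G : ℕ → ℝ → ℝ := fun n t => ∑ x : Config (N n),
    fieldWeight (t * fieldScale (total (N n))) x * f (normalisedMagnetisation (3 / 4) x)
  have hG : ∀ n, Continuous (G n) := fun n => continuous_finsetSum _ fun x _ =>
    ((continuous_fieldWeight x).comp (continuous_id.mul continuous_const)).mul continuous_const
  have hGbd : ∀ n t, |G n t| ≤ |f 0| + C := fun n t => by
    refine (Finset.abs_sum_le_sum_abs _ _).trans ?_
    calc _ ≤ ∑ x : Config (N n), fieldWeight (t * fieldScale (total (N n))) x * (|f 0| + C) := by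
          refine Finset.sum_le_sum fun x _ => ?_
          rw [abs_mul, abs_of_nonneg (fieldWeight_nonneg _ x)]
          exact mul_le_mul_of_nonneg_left (hbd _) (fieldWeight_nonneg _ x)
      _ = _ := by rw [← Finset.sum_mul, sum_fieldWeight, one_mul]
  have hGlim : ∀ t, Tendsto (fun n => G n t) atTop (𝓝 (f (limitLine α t))) := fun t => by
    have h1 := (hL.continuous.tendsto _).comp (tendsto_fieldMean hN hT hα t)
    have h2 : Tendsto (fun n => (L : ℝ) * ∑ ν, √(N n ν : ℝ) / (N n ν : ℝ) ^ (3 / 4 : ℝ))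
        atTop (𝓝 0) := by
      simpa using (tendsto_finsetSum Finset.univ fun ν _ =>
        tendsto_sqrt_div_rpow.comp (hN ν)).const_mul (L : ℝ)
    have h3 : Tendsto (fun n => G n t - f (fieldMean (t * fieldScale (total (N n))) (N n))) atTop
        (𝓝 0) := squeeze_zero_norm (fun n => abs_sum_fieldWeight_sub_le (N n)
      (t * fieldScale (total (N n))) hL) h2
    simpa [G] using h3.add h1
  have hnum := tendsto_integral_fieldDensity_mul hT hG hGbd hGlim
  have hden : Tendsto (fun n => ∫ t, fieldDensity (total (N n)) t) atTop (𝓝 quarticConst) := by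
    simpa [quarticConst] using tendsto_integral_fieldDensity_mul hT (G := fun _ _ => 1)
      (g := fun _ => 1) (C := 1) (fun _ => continuous_const) (by simp)
      (fun _ => tendsto_const_nhds)
  rw [integral_limitLaw α hL.continuous, integral_quarticMeasure]
  refine (hnum.div hden quarticConst_pos.ne').congr' ?_
  filter_upwards [hT.eventually_gt_atTop 0] with n hn
  rw [integral_normalisedLaw_eq_field _ _ hn hL.continuous.measurable]
  rfl

end CurieWeiss
end

theorem mainTheorem3 (M : ℕ) (α : Fin M → ℝ) (hα_nonneg : ∀ ν, 0 ≤ α ν) (hα_sum : ∑ ν, α ν = 1) :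
    ∃ μ : ProbabilityMeasure (Fin M → ℝ),
      (∀ N : ℕ → Fin M → ℕ,
        (∀ ν, Tendsto (fun n => N n ν) atTop atTop) →
        (∀ ν, Tendsto (fun n => (N n ν : ℝ) / (CurieWeiss.total (N n) : ℝ)) atTop (𝓝 (α ν))) →
        Tendsto (fun n => CurieWeiss.normalisedLaw (CurieWeiss.homogeneousCoupling M 1) (3 / 4) (N n))
          atTop (𝓝 μ)) ∧
      (∀ K : Fin M → ℕ,
        Integrable (fun x : Fin M → ℝ => ∏ ν, x ν ^ K ν) (μ : Measure (Fin M → ℝ)) ∧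
        (Even (∑ ν, K ν) →
          ∫ x : Fin M → ℝ, ∏ ν, x ν ^ K ν ∂(μ : Measure (Fin M → ℝ)) =
            (12 : ℝ) ^ (((∑ ν, K ν : ℕ) : ℝ) / 4) *
              (Real.Gamma ((((∑ ν, K ν : ℕ) : ℝ) + 1) / 4) / Real.Gamma (1 / 4)) *
              ∏ ν, α ν ^ ((K ν : ℝ) / 4)) ∧
        (Odd (∑ ν, K ν) →
          ∫ x : Fin M → ℝ, ∏ ν, x ν ^ K ν ∂(μ : Measure (Fin M → ℝ)) = 0)) := by
  -- An empty sum cannot be `1`. One group then suffices to force the total size to infinity.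
  have hM : Nonempty (Fin M) := by
    by_contra h
    rw [not_nonempty_iff] at h
    simp at hα_sum
  refine ⟨CurieWeiss.limitLaw α, fun N hN hα => ?_, fun K =>
    ⟨CurieWeiss.integrable_prod_pow_limitLaw hα_nonneg K, fun hK => ?_, fun hK => ?_⟩⟩
  · refine CurieWeiss.tendsto_normalisedLaw hN ?_ hα
    exact tendsto_atTop_mono (fun n => Finset.single_le_sum (f := N n)
      (fun _ _ => Nat.zero_le _) (Finset.mem_univ hM.some)) (hN hM.some)
  · rw [CurieWeiss.integral_prod_pow_limitLaw hα_nonneg,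
      CurieWeiss.integral_pow_quarticMeasure_of_even hK]
  · rw [CurieWeiss.integral_prod_pow_limitLaw hα_nonneg,
      CurieWeiss.integral_pow_quarticMeasure_of_odd hK, zero_mul]
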